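/- Let $d>2$. A marked polynomial of degree $d$ is a pair $(f,c)$, where $f\in\mathbb{C}[z]$ has degree $d$ and $c\in\mathbb{C}$ satisfies $f'(c)=0$. Two marked polynomials $(f,c)$ and $(g,c')$ are conjugate if there is an affine map $h(z)=az+b$, $a\neq 0$, with $g=h\circ f\circ h^{-1}$ and $h(c)=c'$. Let $\mathcal{M}_d$ be the set of conjugacy classes. Every class is represented by some monic reduced polynomial (its coefficient of $z^{d-1}$ is zero) in the normal form $$f_{\alpha,\beta}(z)=z^{d}+\sum_{i=2}^{d-1}(-1)^i\frac{d}{d-i}s_i(\alpha)\,\bigl(z^{d-i}-\alpha_1^{d-i}\bigr)-\alpha_1^{d}+\beta ,\qquad \sum_{i=1}^{d-1}\alpha_i=0,$$ with marked critical point $\alpha_1$. Here $\alpha=(\alpha_1,\dots,\alpha_{d-1})$ lists the critical points of $f_{\alpha,\beta}$ with multiplicity, $\beta=f_{\alpha,\beta}(\alpha_1)$, and $s_i$ is the $i$-th elementary symmetric polynomial. This identifies $\mathcal{M}_d$ with the affine variety $V/G$, where $V=\{(\alpha,\beta)\in\mathbb{C}^{d}:\sum_i\alpha_i=0\}$ and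 $G$ is the finite group generated by the permutations of $\alpha_2,\dots,\alpha_{d-1}$ and by multiplication of all coordinates by $(d-1)$-th roots of unity. Its regular functions are the functions on $\mathcal{M}_d$ whose pullback to $V$ is polynomial. In the Zariski topology on $\mathcal{M}_d$ the closed sets are the common zero sets of families of regular functions. For integers $k\ge 0$ and $n\ge 1$, a point $x\in\mathbb{C}$ is strictly $(k,n)$-preperiodic under $f$ if $f^{k+n}(x)=f^{k}(x)$ (where $f^m$ denotes the $m$-th iterate) and $f^{l+m}(x)\ne f^{l}(x)$ for all $0\le l\le k$, $1\le m\le n$ with $(l,m)\neq(k,n)$. Let $\Sigma_{k,n,d}\subseteq\mathcal{M}_d$ be the set of classes of marked polynomials $(f,c)$ such that $c$ is strictly $(k,n)$-preperiodic under $f$. **Theorem.** For every integer $k\ge 0$ and every odd prime $p$, the set $\Sigma_{k,1,p}$ is a quasi-affine algebraic set (that is, it is locally closed in $\mathcal{M}_p$), and it is irreducible (in particular non-empty) in the Zariski topology of $\mathcal{M}_p$. -/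

import Mathlib

open Polynomial

/-- `x` is strictly `(k, n)`-preperiodic under `g`: `g^{k+n}(x) = g^k(x)`, and no smaller pair
`(l, m)` with `0 ≤ l ≤ k`, `1 ≤ m ≤ n` satisfies the corresponding equation. -/
def StrictlyPreperiodic (g : ℂ → ℂ) (k n : ℕ) (x : ℂ) : Prop :=
  g^[k + n] x = g^[k] x ∧
    ∀ l m : ℕ, l ≤ k → 1 ≤ m → m ≤ n → (l, m) ≠ (k, n) → g^[l + m] x ≠ g^[l] x

/-- A complex polynomial of degree `d` together with a marked finite critical point. -/
structure MarkedPoly (d : ℕ) where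
  poly : ℂ[X]
  crit : ℂ
  natDegree_eq : poly.natDegree = d
  isCritical : poly.derivative.eval crit = 0

/-- Affine conjugacy of marked polynomials: for some `h(z) = a z + b` with `a ≠ 0` one has
`g ∘ h = h ∘ f` (that is, `g = h ∘ f ∘ h⁻¹`), and `h` sends the marked critical point of `f` to
that of `g`. -/
def MarkedPoly.Conj {d : ℕ} (f g : MarkedPoly d) : Prop :=
  ∃ a b : ℂ, a ≠ 0 ∧ g.poly.comp (C a * X + C b) = (C a * X + C b).comp f.poly ∧
    g.crit = a * f.crit + b

theorem MarkedPoly.conj_refl {d : ℕ} (f : MarkedPoly d) : f.Conj f :=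
  ⟨1, 0, one_ne_zero, by simp, by simp⟩

theorem MarkedPoly.conj_symm {d : ℕ} {f g : MarkedPoly d} (h : f.Conj g) : g.Conj f := by
  obtain ⟨a, b, ha, h1, h2⟩ := h
  refine ⟨a⁻¹, -(a⁻¹ * b), inv_ne_zero ha, ?_, ?_⟩
  · apply Polynomial.funext
    intro z
    have := congrArg (Polynomial.eval (a⁻¹ * z + -(a⁻¹ * b))) h1
    simp only [eval_comp, eval_add, eval_mul, eval_C, eval_X] at this ⊢
    have hz : a * (a⁻¹ * z + -(a⁻¹ * b)) + b = z := by field_simp; ring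
    rw [hz] at this
    rw [this]
    field_simp
    ring
  · rw [h2]
    field_simp
    ring

theorem MarkedPoly.conj_trans {d : ℕ} {f g e : MarkedPoly d} (h : f.Conj g) (h' : g.Conj e) :
    f.Conj e := by
  obtain ⟨a, b, ha, h1, h2⟩ := h
  obtain ⟨a', b', ha', h1', h2'⟩ := h'
  refine ⟨a' * a, a' * b + b', mul_ne_zero ha' ha, ?_, ?_⟩
  · apply Polynomial.funext
    intro z
    have e1 := congrArg (Polynomial.eval z) h1
    have e2 := congrArg (Polynomial.eval (a * z + b)) h1'
    simp only [eval_comp, eval_add, eval_mul, eval_C, eval_X] at e1 e2 ⊢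
    rw [e1] at e2
    have hz : a' * a * z + (a' * b + b') = a' * (a * z + b) + b' := by ring
    rw [hz, e2]
    ring
  · rw [h2', h2]
    ring

instance MarkedPoly.setoid (d : ℕ) : Setoid (MarkedPoly d) where
  r := MarkedPoly.Conj
  iseqv := ⟨MarkedPoly.conj_refl, MarkedPoly.conj_symm, MarkedPoly.conj_trans⟩

/-- The moduli space of polynomials of degree `d` with a marked critical point, modulo affine
conjugation. -/
def ModuliSpace (d : ℕ) : Type := Quotient (MarkedPoly.setoid d)

/-- The point of the moduli space represented by a marked polynomial. -/
def MarkedPoly.toModuli {d : ℕ} (f : MarkedPoly d) : ModuliSpace d :=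
  Quotient.mk (MarkedPoly.setoid d) f

/-- `z ^ d + ∑_{i=2}^{d-1} (-1)^i (d / (d - i)) s_i(α) z ^ (d - i)`, where `s_i` is the `i`-th
elementary symmetric polynomial in the `d - 1` numbers `α` (here `d - 2 + 1 = d - 1` for
`2 ≤ d`). -/
noncomputable def normalFormAux (d : ℕ) (α : Fin (d - 2 + 1) → ℂ) : ℂ[X] :=
  X ^ d + ∑ i ∈ Finset.Icc 2 (d - 1),
    C ((-1) ^ i * ((d : ℂ) / ((d - i : ℕ) : ℂ)) *
      MvPolynomial.eval α (MvPolynomial.esymm (Fin (d - 2 + 1)) ℂ i)) * X ^ (d - i)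

/-- The normal form: when `∑ i, α i = 0`, the monic reduced polynomial of degree `d` whose
critical points, with multiplicity, are the `α i`, and which takes the value `β` at the marked
critical point `α 0`. -/
noncomputable def normalForm (d : ℕ) (α : Fin (d - 2 + 1) → ℂ) (β : ℂ) : ℂ[X] :=
  normalFormAux d α - C ((normalFormAux d α).eval (α 0)) + C β

/-- A function on the moduli space is regular if in the coordinates `(α, β)` of the normal form,
on the hyperplane `∑ i, α i = 0`, it is given by a polynomial. Equivalently it comes from a
polynomial on this hyperplane which is invariant under the finite group generated by the
permutations of the unmarked `α i` and by the `(d-1)`-th roots of unity. -/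
def IsRegularFunction {d : ℕ} (φ : ModuliSpace d → ℂ) : Prop :=
  ∃ F : MvPolynomial (Fin (d - 2 + 1) ⊕ Unit) ℂ,
    ∀ (f : MarkedPoly d) (α : Fin (d - 2 + 1) → ℂ) (β : ℂ), ∑ i, α i = 0 →
      f.poly = normalForm d α β → f.crit = α 0 →
        φ f.toModuli = MvPolynomial.eval (Sum.elim α fun _ => β) F

/-- The common zeros of a set of functions on the moduli space. -/
def commonZeros {d : ℕ} (T : Set (ModuliSpace d → ℂ)) : Set (ModuliSpace d) :=
  {x | ∀ φ ∈ T, φ x = 0}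

/-- The Zariski topology on the moduli space: the closed sets are the sets of common zeros of
regular functions. -/
instance ModuliSpace.zariskiTopology (d : ℕ) : TopologicalSpace (ModuliSpace d) :=
  TopologicalSpace.ofClosed
    {Z | ∃ T : Set (ModuliSpace d → ℂ), (∀ φ ∈ T, IsRegularFunction φ) ∧ Z = commonZeros T}
    ⟨{fun _ => 1}, by
      rintro φ rfl
      exact ⟨1, fun f α β _ _ _ => by simp⟩, by
      ext x
      simp [commonZeros]⟩
    (by
      intro A hA
      refine ⟨{φ | IsRegularFunction φ ∧ ∃ Z ∈ A, ∀ x ∈ Z, φ x = 0}, fun φ h => h.1, ?_⟩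
      ext x
      constructor
      · rintro hx φ ⟨_, Z, hZ, hφ⟩
        exact hφ x (hx Z hZ)
      · intro hx Z hZ
        obtain ⟨T, hT, hZT⟩ := hA hZ
        rw [hZT]
        intro φ hφ
        refine hx φ ⟨hT φ hφ, Z, hZ, fun y hy => ?_⟩
        rw [hZT] at hy
        exact hy φ hφ)
    (by
      rintro Z ⟨T, hT, rfl⟩ Z' ⟨T', hT', rfl⟩
      refine ⟨{χ | ∃ φ ∈ T, ∃ ψ ∈ T', χ = fun x => φ x * ψ x}, ?_, ?_⟩
      · rintro χ ⟨φ, hφ, ψ, hψ, rfl⟩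
        obtain ⟨F, hF⟩ := hT φ hφ
        obtain ⟨G, hG⟩ := hT' ψ hψ
        refine ⟨F * G, fun f α β h0 h1 h2 => ?_⟩
        rw [map_mul, ← hF f α β h0 h1 h2, ← hG f α β h0 h1 h2]
      · ext x
        constructor
        · rintro (hx | hx) χ ⟨φ, hφ, ψ, hψ, rfl⟩
          · simp [hx φ hφ]
          · simp [hx ψ hψ]
        · intro hx
          by_contra hcon
          simp only [Set.mem_union, not_or, commonZeros, Set.mem_ofPred_eq, not_forall] at hcon
          obtain ⟨⟨φ, hφ, h1⟩, ⟨ψ, hψ, h2⟩⟩ := hcon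
          exact mul_ne_zero h1 h2 (hx _ ⟨φ, hφ, ψ, hψ, rfl⟩))

/-- The set of points of the moduli space at which the marked critical point is strictly
`(k, n)`-preperiodic. -/
def SigmaSet (k n d : ℕ) : Set (ModuliSpace d) :=
  {x | ∃ f : MarkedPoly d, f.toModuli = x ∧
    StrictlyPreperiodic (fun z => f.poly.eval z) k n f.crit}

/-! Moving the marked critical point to `0` and normalizing to a monic polynomial, every class is
represented by `f(z) = z ^ 2 * G(z) + b`, where `G` is determined by the other critical points `u`.
Thus affine space with coordinates `(u, b)` surjects onto the moduli space, and regular functions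
pull back to polynomials in `(u, b)`.

Let `a_j` be the orbit of `0`. Since `f(x) - f(y)` is divisible by `x - y`, the difference `a_{k+2}
- a_{k+1}` equals `(a_{k+1} - a_k) * b * Q_k` with `Q_k = orbitFactor G k` (`normOrbit_succ_sub`).
So the preimage of the `(k+1, 1)` locus is `Q_k = 0` with `a_{k+1} ≠ a_k` imposed, and it suffices
that `Q_k` is irreducible over `ℂ` and does not divide `a_{k+1} - a_k`. The Nullstellensatz then
gives irreducibility of the image (`isIrreducible_of_prime`). For `k = 0` the locus is simply `b =
0`.

Irreducibility of the monic `Q_k` may be tested after specializing `u` to `(N * t, N, …, N)` with `N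
= (p - 1)!`. This family is defined over `ℤ[t]` and reduces to `z ^ p + b` modulo `p`, where
additivity of Frobenius makes `Q_k` a power of `b`. Its constant term is `p * m * t` times `1` or
`2`, with `p ∤ m`, so for odd `p` Eisenstein's criterion at `p` applies
(`orbitFactor_irreducible_int`). The simple zero of the constant term at `t = 0` singles out one
geometric factor, which is therefore Galois invariant; this upgrades irreducibility over `ℤ` to
irreducibility over `ℂ` (`Irreducible.map_complex`). -/

/-- For `G ∈ D[z]`, the critical orbit of `z ^ 2 * G(z) + b` at `0`, divided by the indeterminate
`b`: the `j`-th iterate of `0` is `X * normOrbit G j`. -/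
noncomputable def normOrbit {D : Type*} [CommRing D] (G : D[X]) : ℕ → D[X]
  | 0 => 0
  | j + 1 => X * normOrbit G j ^ 2 * G.comp (X * normOrbit G j) + 1

/-- The quotient `(a_{k+2} - a_{k+1}) / (b * (a_{k+1} - a_k))`, where `a` is the critical orbit of
`z ^ 2 * G(z) + b`. -/
noncomputable def orbitFactor {D : Type*} [CommRing D] (G : D[X]) (k : ℕ) : D[X] :=
  G.sum fun i c => C c * X ^ i *
    ∑ j ∈ Finset.range (i + 2), normOrbit G (k + 1) ^ j * normOrbit G k ^ (i + 2 - 1 - j)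

/-! ### Algebra of the critical orbit and its difference factors -/

section OrbitAlgebra

variable {D D' : Type*} [CommRing D] [CommRing D']

theorem normOrbit_map (φ : D →+* D') (G : D[X]) (j : ℕ) :
    (normOrbit G j).map φ = normOrbit (G.map φ) j := by
  induction j with
  | zero => simp [normOrbit]
  | succ j ih => simp [normOrbit, Polynomial.map_comp, ih]

theorem X_mul_normOrbit_succ (G : D[X]) (j : ℕ) :
    X * normOrbit G (j + 1) =
      (X * normOrbit G j) ^ 2 * G.comp (X * normOrbit G j) + X := by
  rw [normOrbit]; ring

/-- Each monomial of `z ^ 2 * G(z)` contributes a difference `x ^ (i + 2) - y ^ (i + 2)`, from which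
the geometric sum splits off `x - y`. The spare factor `X` survives because `z ^ 2 * G(z)` vanishes
to order two at `0`. -/
theorem normOrbit_succ_sub (G : D[X]) (k : ℕ) :
    normOrbit G (k + 2) - normOrbit G (k + 1) =
      (normOrbit G (k + 1) - normOrbit G k) * (X * orbitFactor G k) := by
  have h (x : D[X]) :
      X * x ^ 2 * G.comp (X * x) = G.sum fun i c => C c * X ^ (i + 1) * x ^ (i + 2) := by
    rw [comp, eval₂_eq_sum, Polynomial.sum, Polynomial.sum, Finset.mul_sum]
    exact Finset.sum_congr rfl fun i _ => by ring
  have h' (x y : D[X]) : X * x ^ 2 * G.comp (X * x) - X * y ^ 2 * G.comp (X * y) =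
      (x - y) * (X * G.sum fun i c => C c * X ^ i *
        ∑ j ∈ Finset.range (i + 2), x ^ j * y ^ (i + 2 - 1 - j)) := by
    rw [h, h, Polynomial.sum, Polynomial.sum, Polynomial.sum, ← Finset.sum_sub_distrib,
      Finset.mul_sum, Finset.mul_sum]
    refine Finset.sum_congr rfl fun i _ => ?_
    rw [← mul_sub, ← geom_sum₂_mul x y (i + 2)]
    ring
  rw [orbitFactor, ← h', normOrbit, add_sub_assoc, normOrbit.eq_2 G k]
  ring

theorem normOrbit_coeff_zero (G : D[X]) (j : ℕ) : (normOrbit G (j + 1)).coeff 0 = 1 := by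
  simp [normOrbit, mul_assoc]

/-- At `b = 0` the normalized orbit is `0, 1, 1, …`, so only the term `i = 0` survives and its
geometric sum is `1 + 0` or `1 + 1`. The resulting `2` is why the prime must be odd. -/
theorem orbitFactor_coeff_zero (G : D[X]) (k : ℕ) :
    (orbitFactor G k).coeff 0 = G.coeff 0 * if k = 0 then 1 else 2 := by
  rw [orbitFactor, Polynomial.sum, finsetSum_coeff, Finset.sum_eq_single 0]
  · have h1 := normOrbit_coeff_zero G k
    simp only [coeff_zero_eq_eval_zero] at h1 ⊢
    rcases k with _ | k
    · simp [Finset.sum_range_succ, h1, normOrbit.eq_1]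
    · have h2 := normOrbit_coeff_zero G k
      simp only [coeff_zero_eq_eval_zero] at h2 
      simp [Finset.sum_range_succ, h1, h2, one_add_one_eq_two]
  · intro i _ hi
    simp [coeff_zero_eq_eval_zero, hi]
  · intro h
    simp [notMem_support_iff.mp h]

section Monic

variable [Nontrivial D] {G : D[X]} {n : ℕ}

theorem normOrbit_monic (hG : G.Monic) (hn : G.natDegree = n) (j : ℕ) :
    (normOrbit G (j + 1)).Monic ∧ (normOrbit G (j + 1)).natDegree = (n + 2) ^ j - 1 := by
  induction j with
  | zero => simp [normOrbit]
  | succ j ih =>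
    obtain ⟨h1, h2⟩ := ih
    have hX : (X * normOrbit G (j + 1)).Monic := monic_X.mul h1
    have hXd : (X * normOrbit G (j + 1)).natDegree = (n + 2) ^ j := by
      rw [monic_X.natDegree_mul h1, h2, natDegree_X]
      have : 0 < (n + 2) ^ j := by positivity
      omega
    have hc : (G.comp (X * normOrbit G (j + 1))).Monic :=
      hG.comp hX (by rw [hXd]; positivity)
    have hcd : (G.comp (X * normOrbit G (j + 1))).natDegree = n * (n + 2) ^ j := by
      rw [natDegree_comp_eq_of_mul_ne_zero (by simp [hG.leadingCoeff, hX.leadingCoeff]), hn, hXd]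
    have hm : (X * normOrbit G (j + 1) ^ 2 * G.comp (X * normOrbit G (j + 1))).Monic :=
      (monic_X.mul (h1.pow 2)).mul hc
    have hmd : (X * normOrbit G (j + 1) ^ 2 * G.comp (X * normOrbit G (j + 1))).natDegree
        = (n + 2) ^ (j + 1) - 1 := by
      rw [(monic_X.mul (h1.pow 2)).natDegree_mul hc, monic_X.natDegree_mul (h1.pow 2),
        h1.natDegree_pow, hcd, h2, natDegree_X, pow_succ]
      have : 0 < (n + 2) ^ j := by positivity
      have h3 : (n + 2) ^ j * (n + 2) = n * (n + 2) ^ j + 2 * (n + 2) ^ j := by ring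
      omega
    have hpos : 0 < (X * normOrbit G (j + 1) ^ 2 * G.comp (X * normOrbit G (j + 1))).natDegree := by
      rw [hmd]
      have : 1 < (n + 2) ^ (j + 1) := Nat.one_lt_pow (by omega) (by omega)
      omega
    rw [normOrbit]
    refine ⟨hm.add_of_left ?_, ?_⟩
    · rw [degree_one]
      exact natDegree_pos_iff_degree_pos.mp hpos
    · rw [← hmd]
      exact natDegree_add_eq_left_of_natDegree_lt (by rw [natDegree_one]; exact hpos)

theorem normOrbit_sub_monic (hG : G.Monic) (hn : G.natDegree = n) (j : ℕ) :
    (normOrbit G (j + 1) - normOrbit G j).Monic ∧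
      (normOrbit G (j + 1) - normOrbit G j).natDegree = (n + 2) ^ j - 1 := by
  obtain ⟨h1, h2⟩ := normOrbit_monic hG hn j
  rcases j with _ | j
  · rw [normOrbit.eq_1, sub_zero]
    exact ⟨h1, h2⟩
  obtain ⟨h3, h4⟩ := normOrbit_monic hG hn j
  have hlt : (normOrbit G (j + 1)).natDegree < (normOrbit G (j + 1 + 1)).natDegree := by
    rw [h2, h4]
    have : (n + 2) ^ j < (n + 2) ^ (j + 1) := Nat.pow_lt_pow_right (by omega) (by omega)
    have : 0 < (n + 2) ^ j := by positivity
    omega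
  refine ⟨h1.sub_of_left (degree_lt_degree hlt), ?_⟩
  rw [natDegree_sub_eq_left_of_natDegree_lt hlt, h2]

/-- Both properties are read off from `normOrbit_succ_sub` by cancelling monic factors and comparing
degrees. -/
theorem orbitFactor_monic (hG : G.Monic) (hn : G.natDegree = n) (k : ℕ) :
    (orbitFactor G k).Monic ∧ (orbitFactor G k).natDegree = (n + 1) * (n + 2) ^ k - 1 := by
  obtain ⟨h1, h2⟩ := normOrbit_sub_monic hG hn k
  obtain ⟨h3, h4⟩ := normOrbit_sub_monic hG hn (k + 1)
  rw [normOrbit_succ_sub, ← mul_assoc] at h3 h4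
  have hm := (h1.mul monic_X).of_mul_monic_left h3
  refine ⟨hm, ?_⟩
  rw [(h1.mul monic_X).natDegree_mul hm, h1.natDegree_mul monic_X, natDegree_X, h2, pow_succ] at h4
  have : 0 < (n + 2) ^ k := by positivity
  have h5 : (n + 2) ^ k * (n + 2) = (n + 1) * (n + 2) ^ k + (n + 2) ^ k := by ring
  have h6 : (n + 1) * (n + 2) ^ k = n * (n + 2) ^ k + (n + 2) ^ k := by ring
  omega

-- Base change may shrink the support of `G`, so instead of comparing the defining sums one compares
-- the two factorizations and cancels a common monic, hence regular, factor.
omit [Nontrivial D] in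
theorem orbitFactor_map [Nontrivial D'] (hG : G.Monic) (φ : D →+* D') (k : ℕ) :
    (orbitFactor G k).map φ = orbitFactor (G.map φ) k := by
  have h1 := congrArg (Polynomial.map φ) (normOrbit_succ_sub G k)
  have h2 := normOrbit_succ_sub (G.map φ) k
  simp only [Polynomial.map_sub, Polynomial.map_mul, normOrbit_map, map_X] at h1
  rw [h1, ← mul_assoc, ← mul_assoc] at h2
  exact (((normOrbit_sub_monic (hG.map φ) rfl k).1.mul monic_X).isRegular.left) h2

end Monic

/-- In characteristic `p` with `p` the degree, for `f(z) = z ^ p + b`. -/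
theorem normOrbit_X_pow_sub {p n : ℕ} [Fact p.Prime] [CharP D p] [IsDomain D] (hp : p = n + 2)
    (k : ℕ) : X * (normOrbit (X ^ n : D[X]) (k + 1) - normOrbit (X ^ n) k) = X ^ p ^ k := by
  induction k with
  | zero => simp [normOrbit]
  | succ k ih =>
    have h (j : ℕ) : X * normOrbit (X ^ n : D[X]) (j + 1) =
        (X * normOrbit (X ^ n : D[X]) j) ^ p + X := by
      rw [X_mul_normOrbit_succ, X_pow_comp, ← pow_add, hp, add_comm 2 n]
    -- The constant `b` cancels in the difference, and additivity of the `p`-th power turns it into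
    -- the `p`-th power of the previous difference.
    calc X * (normOrbit (X ^ n : D[X]) (k + 2) - normOrbit (X ^ n) (k + 1))
        = (X * normOrbit (X ^ n : D[X]) (k + 1)) ^ p - (X * normOrbit (X ^ n : D[X]) k) ^ p := by
          linear_combination h (k + 1) - h k
      _ = (X * (normOrbit (X ^ n : D[X]) (k + 1) - normOrbit (X ^ n) k)) ^ p := by
          rw [mul_sub, sub_pow_char]
      _ = X ^ p ^ (k + 1) := by rw [ih, ← pow_mul, pow_succ]

theorem orbitFactor_X_pow {p n : ℕ} [Fact p.Prime] [CharP D p] [IsDomain D] (hp : p = n + 2)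
    (k : ℕ) : orbitFactor (X ^ n : D[X]) k = X ^ ((n + 1) * p ^ k - 1) := by
  have h1 := normOrbit_X_pow_sub (D := D) hp k
  have h2 := normOrbit_X_pow_sub (D := D) hp (k + 1)
  rw [normOrbit_succ_sub, ← mul_assoc, h1, ← mul_assoc, ← pow_succ] at h2
  have h3 : p ^ (k + 1) = p ^ k + 1 + ((n + 1) * p ^ k - 1) := by
    have h4 : 0 < p ^ k := by have := (Fact.out : p.Prime).pos; positivity
    have h5 : 0 < (n + 1) * p ^ k := Nat.mul_pos n.succ_pos h4
    have h6 : p ^ (k + 1) = p ^ k + (n + 1) * p ^ k := by rw [pow_succ]; nth_rw 2 [hp]; ring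
    omega
  have h7 : (X ^ (p ^ k + 1) : D[X]) ≠ 0 := pow_ne_zero _ X_ne_zero
  refine mul_left_cancel₀ h7 (h2.trans ?_)
  rw [← pow_add, ← h3]

end OrbitAlgebra

/-! ### Eisenstein irreducibility over `ℤ[t]` and descent from `ℂ` -/

section AbsoluteIrreducibility

theorem exists_monic_associated_of_dvd_monic {A : Type*} [CommRing A] [IsDomain A] {Q g : A[X]}
    (hQ : Q.Monic) (hg : g ∣ Q) : ∃ g' : A[X], g'.Monic ∧ Associated g g' := by
  obtain ⟨h, rfl⟩ := hg
  have h1 : g.leadingCoeff * h.leadingCoeff = 1 := by rw [← leadingCoeff_mul]; exact hQ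
  refine ⟨g * C h.leadingCoeff, ?_, ?_⟩
  · rw [Monic, leadingCoeff_mul, leadingCoeff_C, h1]
  · exact associated_mul_unit_right _ _ (isUnit_C.mpr (IsUnit.of_mul_eq_one _ ((mul_comm _ _).trans h1)))

theorem exists_irreducible_dvd_map_eq_zero {A B : Type*} [CommRing A] [IsDomain A]
    [UniqueFactorizationMonoid A] [CommRing B] [IsDomain B] (φ : A →+* B) {Q : A} (hQ : Q ≠ 0)
    (h : φ Q = 0) : ∃ g, Irreducible g ∧ g ∣ Q ∧ φ g = 0 := by
  have h1 := (UniqueFactorizationMonoid.factors_prod hQ).map φ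
  rw [h, associated_zero_iff_eq_zero, map_multiset_prod, Multiset.prod_eq_zero_iff,
    Multiset.mem_map] at h1
  obtain ⟨g, hg, hg0⟩ := h1
  exact ⟨g, UniqueFactorizationMonoid.irreducible_of_factor g hg,
    UniqueFactorizationMonoid.dvd_of_mem_factors hg, hg0⟩

attribute [local instance] Polynomial.algebra in
/-- The coefficients of a monic factor of a monic polynomial over `ℤ[t]` are integral. -/
theorem isIntegral_coeff_coeff_of_dvd {K : Type*} [Field K] {q : ℤ[X][X]} (hq : q.Monic)
    {g : K[X][X]} (hg : g.Monic) (h : g ∣ q.map (mapRingHom (Int.castRingHom K))) (i j : ℕ) :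
    IsIntegral ℤ ((g.coeff i).coeff j) :=
  isIntegral_iff_isIntegral_coeff.mp (isIntegral_coeff_of_dvd (R := ℤ[X]) q g hq hg h i) j

theorem exists_monic_map_map_eq {A B : Type*} [CommRing A] [CommRing B] [Nontrivial B]
    (φ : A →+* B)
    {g : B[X][X]} (hg : g.Monic) (h : ∀ i j, (g.coeff i).coeff j ∈ Set.range φ) :
    ∃ g' : A[X][X], g'.map (mapRingHom φ) = g ∧ g'.Monic := by
  have h1 : g ∈ lifts (mapRingHom φ) := by
    rw [lifts_iff_coeff_lifts]
    intro i
    have h2 : g.coeff i ∈ lifts φ := by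
      rw [lifts_iff_coeff_lifts]
      exact h i
    exact (mem_lifts _).mp h2
  obtain ⟨g', h3, -, h4⟩ := lifts_and_natDegree_eq_and_monic h1 hg
  exact ⟨g', h3, h4⟩

/-- A monic irreducible polynomial over `ℤ[t]` whose constant coefficient has a simple zero at
`t = 0` stays irreducible over a Galois extension of `ℚ`. -/
theorem Irreducible.map_of_isGalois {q : ℤ[X][X]} (hq : q.Monic) (hirr : Irreducible q) {a : ℤ}
    (ha : a ≠ 0) (h0 : q.coeff 0 = C a * X) (K : Type*) [Field K] [Algebra ℚ K] [IsGalois ℚ K] :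
    Irreducible (q.map (mapRingHom (Int.castRingHom K))) := by
  have : CharZero K := algebraRat.charZero K
  set Q := q.map (mapRingHom (Int.castRingHom K)) with hQdef
  have hQ : Q.Monic := hq.map _
  have hQ0 : Q.coeff 0 = C (a : K) * X := by simp [hQdef, h0]
  -- Evaluation at the origin of the `(t, b)`-plane; `g` will be the monic irreducible factor
  -- passing through it.
  let ev : K[X][X] →+* K := constantCoeff.comp constantCoeff
  have hev : ev Q = 0 := by simp [ev, hQ0]
  obtain ⟨g₀, hg₀, hg₀Q, hevg₀⟩ := exists_irreducible_dvd_map_eq_zero ev hQ.ne_zero hev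
  obtain ⟨g, hgm, hass⟩ := exists_monic_associated_of_dvd_monic hQ hg₀Q
  have hg : Irreducible g := hass.irreducible hg₀
  have hgQ : g ∣ Q := hass.dvd_iff_dvd_left.mp hg₀Q
  have hevg : ev g = 0 := by
    have := hass.map ev
    rwa [hevg₀, Associated.comm, associated_zero_iff_eq_zero] at this
  obtain ⟨h, hgh⟩ := hgQ
  -- If the complementary factor also vanished at the origin, `t ^ 2` would divide the constant
  -- coefficient `a * t`.
  have hevh : ev h ≠ 0 := by
    intro hh
    have h1 : X ∣ g.coeff 0 := X_dvd_iff.mpr hevg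
    have h2 : X ∣ h.coeff 0 := X_dvd_iff.mpr hh
    have h3 : X * X ∣ C (a : K) * X := by
      rw [← hQ0, hgh, mul_coeff_zero]
      exact mul_dvd_mul h1 h2
    rw [mul_dvd_mul_iff_right X_ne_zero, X_dvd_iff, coeff_C_zero] at h3
    exact ha (by exact_mod_cast h3)
  -- The conjugate of `h` is still nonzero at the origin, so the prime `g` cannot divide it and must
  -- divide the conjugate of `g`; both are monic, and the degrees force equality.
  have hfix (σ : K ≃ₐ[ℚ] K) : g.map (mapRingHom (σ : K →+* K)) = g := by
    set Φ := mapRingHom (σ : K →+* K) with hΦ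
    have hΦQ : Q.map Φ = Q := by
      rw [hQdef, Polynomial.map_map, hΦ, mapRingHom_comp,
        RingHom.ext_int ((σ : K →+* K).comp (Int.castRingHom K)) (Int.castRingHom K)]
    have h1 : g ∣ g.map Φ * h.map Φ := by
      rw [← Polynomial.map_mul, ← hgh, hΦQ]
      exact ⟨h, hgh⟩
    have h2 : ¬ g ∣ h.map Φ := by
      rintro ⟨s, hs⟩
      have h3 := congrArg ev hs
      rw [map_mul, hevg, zero_mul] at h3
      have h4 : ev (h.map Φ) = σ (ev h) := by simp [ev, hΦ]
      rw [h4, map_eq_zero_iff _ σ.injective] at h3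
      exact hevh h3
    exact (eq_of_monic_of_dvd_of_natDegree_le hgm (hgm.map Φ)
      ((hg.prime.dvd_or_dvd h1).resolve_right h2) natDegree_map_le)
  -- Galois-fixed coefficients are rational; being integral over `ℤ` as well, they are integers.
  have hint (i j : ℕ) : (g.coeff i).coeff j ∈ Set.range (Int.castRingHom K) := by
    have h1 : (g.coeff i).coeff j ∈ Set.range (algebraMap ℚ K) := by
      rw [InfiniteGalois.mem_range_algebraMap_iff_fixed]
      intro σ
      have h2 := congrArg (fun r => (r.coeff i).coeff j) (hfix σ)
      simpa using h2
    obtain ⟨r, hr⟩ := h1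
    have h2 := isIntegral_coeff_coeff_of_dvd hq hgm ⟨h, hgh⟩ i j
    rw [← hr, isIntegral_algebraMap_iff (algebraMap ℚ K).injective,
      IsIntegrallyClosed.isIntegral_iff] at h2
    obtain ⟨m, hm⟩ := h2
    refine ⟨m, ?_⟩
    rw [← hr, ← hm]
    simp
  obtain ⟨g', hg', hgm'⟩ := exists_monic_map_map_eq _ hgm hint
  have hinj : Function.Injective (mapRingHom (Int.castRingHom K)) :=
    map_injective _ (RingHom.injective_int _)
  have hdvd : g' ∣ q := by
    rw [← map_dvd_map _ hinj hgm', hg']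
    exact ⟨h, hgh⟩
  obtain ⟨s, hs⟩ := hdvd
  have hsm : s.Monic := hgm'.of_mul_monic_left (hs ▸ hq)
  rcases hirr.isUnit_or_isUnit hs with hu | hu
  · exact absurd (hg' ▸ hu.map (mapRingHom (mapRingHom (Int.castRingHom K)))) hg.not_isUnit
  · rw [hsm.eq_one_of_isUnit hu, mul_one] at hs
    rw [hQdef, hs, hg']
    exact hg

/-- Monic factors over `ℂ` have coefficients integral over `ℤ`, hence algebraic, so any
factorization already lives over the algebraic closure of `ℚ` in `ℂ`, which is Galois over `ℚ`. -/
theorem Irreducible.map_complex {q : ℤ[X][X]} (hq : q.Monic) (hirr : Irreducible q) {a : ℤ}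
    (ha : a ≠ 0) (h0 : q.coeff 0 = C a * X) :
    Irreducible (q.map (mapRingHom (Int.castRingHom ℂ))) := by
  let K := algebraicClosure ℚ ℂ
  have : IsAlgClosure ℚ K := algebraicClosure.isAlgClosure ℚ ℂ
  have : Normal ℚ K := IsAlgClosure.normal ℚ K
  have : IsGalois ℚ K := ⟨⟩
  have hK := Irreducible.map_of_isGalois hq hirr ha h0 K
  set ι : K →+* ℂ := algebraMap K ℂ
  have hι : Function.Injective (mapRingHom ι) := map_injective _ ι.injective
  have hcomp : q.map (mapRingHom (Int.castRingHom ℂ)) =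
      (q.map (mapRingHom (Int.castRingHom K))).map (mapRingHom ι) := by
    rw [Polynomial.map_map, mapRingHom_comp,
      RingHom.ext_int (ι.comp (Int.castRingHom K)) (Int.castRingHom ℂ)]
  have hlift {f : ℂ[X][X]} (hf : f.Monic) (hd : f ∣ q.map (mapRingHom (Int.castRingHom ℂ))) :
      ∃ f' : K[X][X], f'.map (mapRingHom ι) = f ∧ f'.Monic := by
    refine exists_monic_map_map_eq ι hf fun i j => ?_
    have h1 := (isIntegral_coeff_coeff_of_dvd hq hf hd i j).tower_top (A := ℚ)
    exact ⟨⟨_, mem_algebraicClosure_iff'.mpr h1⟩, rfl⟩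
  have hne : q.map (mapRingHom (Int.castRingHom ℂ)) ≠ 1 := by
    intro h1
    rw [hcomp] at h1
    have h2 := map_injective _ hι (h1.trans (Polynomial.map_one _).symm)
    exact hK.ne_one h2
  rw [irreducible_of_monic (hq.map _) hne]
  intro f g hf hg hfg
  obtain ⟨f', rfl, hf'⟩ := hlift hf ⟨g, hfg.symm⟩
  obtain ⟨g', rfl, hg'⟩ := hlift hg ⟨_, (mul_comm _ _).trans hfg |>.symm⟩
  rw [hcomp, ← Polynomial.map_mul] at hfg
  rcases hK.isUnit_or_isUnit (map_injective _ hι hfg).symm with hu | hu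
  · left; rw [hf'.eq_one_of_isUnit hu, Polynomial.map_one]
  · right; rw [hg'.eq_one_of_isUnit hu, Polynomial.map_one]

/-- Eisenstein's criterion at the prime ideal `p ℤ[t]`: modulo `p` the polynomial is a pure power of
`b`, while its constant coefficient is `p * m * t` or `2 * p * m * t`, not divisible by `p ^ 2`. -/
theorem orbitFactor_irreducible_int {p n : ℕ} (hp : p.Prime) (hp2 : p ≠ 2) (hpn : p = n + 2)
    {G : ℤ[X][X]} (hG : G.Monic) (hn : G.natDegree = n)
    (hGp : G.map (mapRingHom (Int.castRingHom (ZMod p))) = X ^ n) {m : ℤ}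
    (hm : ¬ (p : ℤ) ∣ m) (hG0 : G.coeff 0 = C (p * m) * X) (k : ℕ) :
    Irreducible (orbitFactor G k) := by
  have : Fact p.Prime := ⟨hp⟩
  have hpp : Prime (p : ℤ) := Nat.prime_iff_prime_int.mp hp
  obtain ⟨hmon, hdeg⟩ := orbitFactor_monic hG hn k
  set φ := mapRingHom (Int.castRingHom (ZMod p))
  set P := RingHom.ker φ with hP
  have hPp : P.IsPrime := RingHom.ker_isPrime φ
  have hspan : P = Ideal.span {C (p : ℤ)} := by
    rw [hP, Polynomial.ker_mapRingHom, ZMod.ker_intCastRingHom, Ideal.map_span,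
      Set.image_singleton]
  have hmap := orbitFactor_map hG φ k
  rw [hGp, orbitFactor_X_pow hpn k] at hmap
  have hpos : 0 < (orbitFactor G k).natDegree := by
    have h1 : 0 < (n + 2) ^ k := by positivity
    have h2 : n * (n + 2) ^ k ≥ n := Nat.le_mul_of_pos_right n h1
    have h3 : (n + 1) * (n + 2) ^ k = n * (n + 2) ^ k + (n + 2) ^ k := by ring
    omega
  refine IsEisensteinAt.irreducible (𝓟 := P) ⟨?_, ?_, ?_⟩ hPp hmon.isPrimitive hpos
  · rw [hmon.leadingCoeff]
    exact fun h => hPp.ne_top ((Ideal.eq_top_iff_one _).mpr h)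
  · intro j hj
    rw [hP, RingHom.mem_ker, ← coeff_map, hmap, coeff_X_pow, if_neg]
    rw [hdeg, ← hpn] at hj
    exact hj.ne
  · rw [hspan, Ideal.span_singleton_pow, Ideal.mem_span_singleton, orbitFactor_coeff_zero, hG0,
      ← C_pow]
    intro h
    have h1 : (p : ℤ) ^ 2 ∣ p * m * if k = 0 then 1 else 2 := by
      have h2 := (C_dvd_iff_dvd_coeff _ _).mp h 1
      split_ifs at h2 ⊢ <;> simpa [mul_assoc, mul_comm] using h2
    rw [pow_two, mul_assoc, mul_dvd_mul_iff_left hpp.ne_zero] at h1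
    rcases hpp.dvd_or_dvd h1 with h2 | h2
    · exact hm h2
    · split_ifs at h2
      · exact hpp.not_isUnit (isUnit_of_dvd_one h2)
      · have : p ∣ 2 := by exact_mod_cast h2
        exact hp2 ((Nat.prime_dvd_prime_iff_eq hp Nat.prime_two).mp this)

theorem orbitFactor_irreducible_complex {p n : ℕ} (hp : p.Prime) (hp2 : p ≠ 2) (hpn : p = n + 2)
    {G : ℤ[X][X]} (hG : G.Monic) (hn : G.natDegree = n)
    (hGp : G.map (mapRingHom (Int.castRingHom (ZMod p))) = X ^ n) {m : ℤ}
    (hm : ¬ (p : ℤ) ∣ m) (hG0 : G.coeff 0 = C (p * m) * X) (k : ℕ) :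
    Irreducible (orbitFactor (G.map (mapRingHom (Int.castRingHom ℂ))) k) := by
  rw [← orbitFactor_map hG]
  refine Irreducible.map_complex (a := p * m * if k = 0 then 1 else 2)
    (orbitFactor_monic hG hn k).1
    (orbitFactor_irreducible_int hp hp2 hpn hG hn hGp hm hG0 k) ?_ ?_
  · refine mul_ne_zero (mul_ne_zero (by exact_mod_cast hp.ne_zero) ?_) (by split_ifs <;> simp)
    rintro rfl
    exact hm (dvd_zero _)
  · rw [orbitFactor_coeff_zero, hG0]
    split_ifs <;> simp; ring

end AbsoluteIrreducibility

/-! ### Recovering the polynomial from its critical points -/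

/-- The polynomial `G(z)`, monic of degree `n`, such that `z ^ 2 * G(z)` has the derivative
`(n + 2) * z * ∏ i, (z - u i)`. -/
noncomputable def cofactor {R : Type*} [CommRing R] [Algebra ℚ R] {n : ℕ} (u : Fin n → R) : R[X] :=
  ∑ j ∈ Finset.range (n + 1),
    C (algebraMap ℚ R ((n + 2) / (j + 2)) * (∏ i, (X - C (u i))).coeff j) * X ^ j

section Cofactor

variable {R : Type*} [CommRing R] [Algebra ℚ R] {n : ℕ} (u : Fin n → R)

omit [Algebra ℚ R] in
theorem natDegree_prod_X_sub_C_fin_le : (∏ i, (X - C (u i))).natDegree ≤ n :=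
  (natDegree_prod_le _ _).trans
    ((Finset.sum_le_sum fun i _ => natDegree_X_sub_C_le (u i)).trans (by simp))

theorem cofactor_coeff (j : ℕ) : (cofactor u).coeff j =
    algebraMap ℚ R ((n + 2) / (j + 2)) * (∏ i, (X - C (u i))).coeff j := by
  simp only [cofactor, finsetSum_coeff, coeff_C_mul_X_pow, Finset.sum_ite_eq, Finset.mem_range]
  split_ifs with h
  · rfl
  · rw [coeff_eq_zero_of_natDegree_lt ((natDegree_prod_X_sub_C_fin_le u).trans_lt (by omega)),
      mul_zero]

omit [Algebra ℚ R] in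
theorem prod_X_sub_C_coeff_fin : (∏ i, (X - C (u i))).coeff n = 1 := by
  nontriviality R
  have h1 := monic_prod_X_sub_C u Finset.univ
  have h2 : (∏ i, (X - C (u i))).natDegree = n := by
    rw [natDegree_prod_of_monic _ _ fun i _ => monic_X_sub_C _]
    simp
  rw [Monic, leadingCoeff, h2] at h1
  exact h1

theorem cofactor_map {R' : Type*} [CommRing R'] [Algebra ℚ R'] (φ : R →+* R') :
    (cofactor u).map φ = cofactor fun i => φ (u i) := by
  ext j
  rw [coeff_map, cofactor_coeff, cofactor_coeff, map_mul, RingHom.map_rat_algebraMap, ← coeff_map,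
    Polynomial.map_prod]
  simp

theorem cofactor_coeff_self : (cofactor u).coeff n = 1 := by
  rw [cofactor_coeff, prod_X_sub_C_coeff_fin, div_self (by positivity), map_one, mul_one]

theorem cofactor_natDegree_le : (cofactor u).natDegree ≤ n := by
  rw [natDegree_le_iff_coeff_eq_zero]
  intro j hj
  rw [cofactor_coeff,
    coeff_eq_zero_of_natDegree_lt ((natDegree_prod_X_sub_C_fin_le u).trans_lt hj), mul_zero]

theorem cofactor_monic : (cofactor u).Monic :=
  monic_of_natDegree_le_of_coeff_eq_one n (cofactor_natDegree_le u) (cofactor_coeff_self u)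

theorem cofactor_natDegree [Nontrivial R] : (cofactor u).natDegree = n :=
  (cofactor_natDegree_le u).antisymm
    (le_natDegree_of_ne_zero (by rw [cofactor_coeff_self]; exact one_ne_zero))

/-- The weight `(n + 2) / (j + 2)` cancels the factor `j + 2` that comes from differentiating `z ^
(j + 2)`. -/
theorem derivative_X_sq_mul_cofactor :
    derivative (X ^ 2 * cofactor u) = C ((n + 2 : ℕ) : R) * X * ∏ i, (X - C (u i)) := by
  ext j
  rw [coeff_derivative, mul_assoc, coeff_C_mul]
  rcases j with _ | j
  · rw [zero_add, coeff_X_mul_zero, coeff_X_pow_mul', if_neg (by omega)]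
    simp
  · rw [coeff_X_mul, show j + 1 + 1 = j + 2 from rfl, coeff_X_pow_mul, cofactor_coeff,
      mul_right_comm]
    congr 1
    have h1 : ((j + 1 : ℕ) : R) + 1 = algebraMap ℚ R (j + 2) := by
      push_cast [map_add, map_natCast, map_ofNat]; ring
    rw [h1, ← map_mul, div_mul_cancel₀ _ (by positivity), map_add, map_natCast, map_ofNat]
    push_cast
    rfl

end Cofactor

/-! ### A one-parameter integral specialization -/

section Specialization

variable {n : ℕ}

/-- Scaling the roots of a product of linear factors scales its coefficients. -/
theorem prod_X_sub_C_mul_coeff {A : Type*} [CommRing A] (c : A) (v : Fin n → A) {j : ℕ}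
    (hj : j ≤ n) :
    (∏ i, (X - C (c * v i))).coeff j = c ^ (n - j) * (∏ i, (X - C (v i))).coeff j := by
  have h (w : Fin n → A) := Multiset.prod_X_sub_C_coeff (Finset.univ.val.map w) (k := j) (by simpa)
  have h1 := h fun i => c * v i
  have h2 := h v
  simp only [Multiset.map_map, Multiset.card_map, Finset.card_val, Finset.card_univ,
    Fintype.card_fin, Function.comp_def] at h1 h2
  rw [Finset.prod, Finset.prod, h1, h2, Finset.esymm_map_val, Finset.esymm_map_val]
  rw [mul_left_comm, Finset.mul_sum (a := c ^ (n - j))]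
  congr 1
  refine Finset.sum_congr rfl fun t ht => ?_
  rw [Finset.prod_mul_distrib, Finset.prod_const, (Finset.mem_powersetCard.mp ht).2]

/-- An integral model of the family with cofactor roots `(N * t, N, …, N)`, where `N` is
`(n + 1)!`. -/
theorem exists_integral_cofactor {p : ℕ} (hp : p.Prime) (hn : 0 < n) (hpn : p = n + 2) :
    ∃ (G : ℤ[X][X]) (m : ℤ) (w : Fin n → ℂ[X]), G.Monic ∧ G.natDegree = n ∧
      G.map (mapRingHom (Int.castRingHom (ZMod p))) = X ^ n ∧ ¬ (p : ℤ) ∣ m ∧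
      G.coeff 0 = C (p * m) * X ∧ G.map (mapRingHom (Int.castRingHom ℂ)) = cofactor w := by
  -- `N` is divisible by every denominator `j + 2` with `j < n`, yet prime to `p = n + 2`.
  set N : ℕ := (n + 1).factorial with hN
  -- Placing `t` in a single slot makes the constant coefficient linear in `t`.
  let v : Fin n → ℤ[X] := fun i => if i = ⟨0, hn⟩ then X else 1
  -- Scaling the roots by `N` multiplies the coefficient of `z ^ j` by `N ^ (n - j)`; one of these
  -- factors `N` absorbs the denominator, leaving `p * c j`.
  let c : ℕ → ℤ := fun j => (N / (j + 2) : ℕ) * N ^ (n - 1 - j)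
  let H : ℤ[X][X] := ∏ i, (X - C (v i))
  let G : ℤ[X][X] := X ^ n + ∑ j ∈ Finset.range n, C (C (p * c j) * H.coeff j) * X ^ j
  set ι := mapRingHom (Int.castRingHom ℂ) with hι
  have hG (j : ℕ) : G.coeff j = if j < n then C (p * c j) * H.coeff j else if j = n then 1 else 0 := by
    simp only [G, coeff_add, coeff_X_pow, finsetSum_coeff, coeff_C_mul_X_pow, Finset.sum_ite_eq,
      Finset.mem_range]
    split_ifs <;> first | omega | simp
  have hmap : G.map ι = cofactor fun i => ι ((N : ℤ[X]) * v i) := by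
    ext1 j
    rw [cofactor_coeff, coeff_map, hG]
    rcases lt_trichotomy j n with hj | rfl | hj
    · rw [if_pos hj]
      have h1 : (∏ i, (X - C (ι ((N : ℤ[X]) * v i)))).coeff j =
          ι ((∏ i, (X - C ((N : ℤ[X]) * v i))).coeff j) := by
        rw [← coeff_map, Polynomial.map_prod]
        simp only [Polynomial.map_sub, map_X, map_C]
      rw [h1, prod_X_sub_C_mul_coeff _ _ hj.le, map_mul ι (C (p * c j)),
        map_mul ι ((N : ℤ[X]) ^ (n - j)), ← mul_assoc (algebraMap ℚ ℂ[X] _)]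
      congr 1
      have h2 : (j + 2) ∣ N := Nat.dvd_factorial (by omega) (by omega)
      have h3 : ((N / (j + 2) : ℕ) : ℚ) = N / (j + 2) := by
        rw [Nat.cast_div h2 (by positivity)]; push_cast; rfl
      have h4 : algebraMap ℚ ℂ[X] ((n + 2) / (j + 2)) * ι ((N : ℤ[X]) ^ (n - j)) =
          algebraMap ℚ ℂ[X] (p * ((N / (j + 2) : ℕ) * N ^ (n - 1 - j))) := by
        rw [map_pow, map_natCast, ← map_natCast (algebraMap ℚ ℂ[X]) N, ← map_pow, ← map_mul]
        congr 1
        rw [h3, hpn, show n - j = n - 1 - j + 1 by omega, pow_succ]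
        push_cast
        ring
      rw [h4]
      simp only [c, map_mul, map_pow, map_natCast]
    · rw [if_neg (lt_irrefl _), if_pos rfl, prod_X_sub_C_coeff_fin, mul_one,
        div_self (by positivity), map_one, map_one]
    · rw [if_neg (by omega), if_neg (by omega), map_zero,
        coeff_eq_zero_of_natDegree_lt ((natDegree_prod_X_sub_C_fin_le _).trans_lt hj), mul_zero]
  have hinj : Function.Injective ι := map_injective _ (RingHom.injective_int _)
  refine ⟨G, (-1) ^ n * c 0, _, ?_, ?_, ?_, ?_, ?_, hmap⟩
  · refine monic_of_injective hinj ?_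
    rw [hmap]
    exact cofactor_monic _
  · rw [← natDegree_map_eq_of_injective hinj, hmap, cofactor_natDegree]
  · ext1 j
    rw [coeff_map, hG, coeff_X_pow]
    split_ifs <;> first | omega | simp
  · have hpp : Prime (p : ℤ) := Nat.prime_iff_prime_int.mp hp
    have hpN : ¬ p ∣ N := fun h => by
      have := (hp.dvd_factorial).mp h
      omega
    intro h
    rcases hpp.dvd_or_dvd h with h | h
    · exact hpp.not_isUnit (isUnit_of_dvd_unit (hpp.dvd_of_dvd_pow h) isUnit_neg_one)
    rcases hpp.dvd_or_dvd h with h | h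
    · have h1 : p ∣ N / (0 + 2) := by exact_mod_cast h
      exact hpN (h1.trans (Nat.div_dvd_of_dvd (Nat.dvd_factorial (by omega) (by omega))))
    · exact hpN (by exact_mod_cast hpp.dvd_of_dvd_pow h)
  · rw [hG, if_pos hn]
    have h1 : H.coeff 0 = (-1) ^ n * X := by
      rw [coeff_zero_eq_eval_zero, eval_prod]
      simp only [eval_sub, eval_X, eval_C, zero_sub, v, Finset.prod_neg]
      rw [Finset.prod_ite_eq' Finset.univ (⟨0, hn⟩ : Fin n) fun _ => (X : ℤ[X])]
      simp
    rw [h1]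
    simp only [map_mul, map_pow, map_neg, map_one]
    ring

end Specialization

/-- For degree `p = n + 2` an odd prime, the factor of the generic critical orbit relation is
irreducible. -/
theorem orbitFactor_cofactor_irreducible {p n : ℕ} (hp : p.Prime) (hn : 0 < n) (hpn : p = n + 2)
    (k : ℕ) :
    Irreducible (orbitFactor (cofactor (MvPolynomial.X : Fin n → MvPolynomial (Fin n) ℂ)) k) := by
  obtain ⟨G, m, w, hG, hGn, hGp, hm, hG0, hGw⟩ := exists_integral_cofactor hp hn hpn
  have hC := orbitFactor_irreducible_complex hp (by omega) hpn hG hGn hGp hm hG0 k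
  -- Specialization preserves the degree of a monic polynomial, so a nontrivial factorization would
  -- survive it.
  set φ : MvPolynomial (Fin n) ℂ →+* ℂ[X] := (MvPolynomial.aeval w).toRingHom with hφ
  refine Monic.irreducible_of_irreducible_map φ _
    (orbitFactor_monic (cofactor_monic _) (cofactor_natDegree _) k).1 ?_
  rw [orbitFactor_map (cofactor_monic _), cofactor_map]
  have : (fun i => φ (MvPolynomial.X i)) = w := by
    funext i
    simp [hφ]
  rwa [this, ← hGw]

/-- A form of the Nullstellensatz for a hypersurface with prime equation. -/
theorem Prime.dvd_of_forall_eval₂_eq_zero {σ : Type*} [Finite σ] {q F : (MvPolynomial σ ℂ)[X]}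
    (hq : Prime q)
    (h : ∀ (u : σ → ℂ) (b : ℂ), q.eval₂ (MvPolynomial.eval u) b = 0 →
      F.eval₂ (MvPolynomial.eval u) b = 0) : q ∣ F := by
  let e := MvPolynomial.optionEquivLeft ℂ σ
  have hev (P : (MvPolynomial σ ℂ)[X]) (x : Option σ → ℂ) :
      MvPolynomial.eval x (e.symm P) =
        P.eval₂ (MvPolynomial.eval fun i => x (some i)) (x none) := by
    have h1 := MvPolynomial.optionEquivLeft_elim_eval ℂ σ (fun i => x (some i)) (x none) (e.symm P)
    rw [show MvPolynomial.optionEquivLeft ℂ σ (e.symm P) = P from e.apply_symm_apply P,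
      ← eval₂_eq_eval_map] at h1
    rw [← h1]
    congr 1
    congr 1
    funext o
    cases o <;> rfl
  have hq' : Prime (e.symm q) := (MulEquiv.prime_iff e.symm.toMulEquiv).mpr hq
  have : (Ideal.span {e.symm q}).IsPrime := (Ideal.span_singleton_prime hq'.ne_zero).mpr hq'
  have hmem : e.symm F ∈ Ideal.span {e.symm q} := by
    -- A prime ideal is the full vanishing ideal of its zero locus.
    rw [← MvPolynomial.IsPrime.vanishingIdeal_zeroLocus (K := ℂ) (Ideal.span {e.symm q}),
      MvPolynomial.mem_vanishingIdeal_iff]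
    intro x hx
    have h1 := hx _ (Ideal.mem_span_singleton_self _)
    rw [MvPolynomial.aeval_eq_eval] at h1 ⊢
    have h2 := hev F x
    have h3 := hev q x
    exact h2.trans (h _ _ (h3.symm.trans h1))
  rw [Ideal.mem_span_singleton] at hmem
  exact (map_dvd_iff e.symm).mp hmem

/-! ### Centered representatives and the normal form -/

section Centered

variable {n : ℕ}

/-- The monic polynomial `z ^ 2 * G(z) + b` with critical points `0` and the `u i`, marked at the
critical point `0`. -/
noncomputable def MarkedPoly.centered (u : Fin n → ℂ) (b : ℂ) : MarkedPoly (n + 2) where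
  poly := X ^ 2 * cofactor u + C b
  crit := 0
  natDegree_eq := by
    rw [natDegree_add_C, (monic_X_pow 2).natDegree_mul (cofactor_monic u), natDegree_X_pow,
      cofactor_natDegree, add_comm]
  isCritical := by
    rw [derivative_add, derivative_C, add_zero, derivative_X_sq_mul_cofactor]
    simp

theorem MarkedPoly.centered_monic (u : Fin n → ℂ) (b : ℂ) : (centered u b).poly.Monic := by
  have h : (X ^ 2 * cofactor u).Monic := (monic_X_pow 2).mul (cofactor_monic u)
  have hd : (X ^ 2 * cofactor u).natDegree = 2 + n := by
    rw [(monic_X_pow 2).natDegree_mul (cofactor_monic u), natDegree_X_pow, cofactor_natDegree]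
  refine h.add_of_left (degree_C_le.trans_lt ?_)
  rw [← natDegree_pos_iff_degree_pos, hd]
  omega

theorem eq_of_derivative_eq_of_eval_zero_eq {P Q : ℂ[X]} (h : derivative P = derivative Q)
    (h0 : P.eval 0 = Q.eval 0) : P = Q := by
  have h1 : derivative (P - Q) = 0 := by rw [derivative_sub, h, sub_self]
  have h2 := eq_C_of_derivative_eq_zero h1
  rw [coeff_sub, coeff_zero_eq_eval_zero, coeff_zero_eq_eval_zero, h0, sub_self, C_0] at h2
  exact sub_eq_zero.mp h2

/-- Vieta's formulas: the factor `d / (d - i)` cancels against differentiation, and the missing `i =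
1` term is zero because the critical points sum to zero. -/
theorem derivative_normalFormAux (α : Fin (n + 1) → ℂ) (hα : ∑ i, α i = 0) :
    derivative (normalFormAux (n + 2) α) = C ((n + 2 : ℕ) : ℂ) * ∏ i, (X - C (α i)) := by
  have h1 := Multiset.prod_X_sub_X_eq_sum_esymm (Finset.univ.val.map α)
  have h2 (j : ℕ) : (Finset.univ.val.map α).esymm j =
      MvPolynomial.eval α (MvPolynomial.esymm (Fin (n + 1)) ℂ j) := by
    rw [← MvPolynomial.aeval_esymm_eq_multiset_esymm (Fin (n + 1)) ℂ, MvPolynomial.aeval_eq_eval]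
  simp only [Multiset.map_map, Multiset.card_map, Finset.card_val, Finset.card_univ,
    Fintype.card_fin, Function.comp_def, h2] at h1
  have h3 : MvPolynomial.eval α (MvPolynomial.esymm (Fin (n + 1)) ℂ 1) = 0 := by
    rw [MvPolynomial.esymm_one, map_sum]
    simpa using hα
  rw [Finset.prod, h1, Finset.sum_range_succ', Finset.sum_range_succ', h3]
  have h4 : Finset.Icc 2 (n + 2 - 1) = (Finset.range n).image (· + 2) := by
    ext i
    simp only [Finset.mem_Icc, Finset.mem_image, Finset.mem_range]
    constructor
    · intro h
      exact ⟨i - 2, by omega, by omega⟩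
    · rintro ⟨j, hj, rfl⟩
      omega
  rw [normalFormAux, h4, Finset.sum_image (by simp), derivative_add, derivative_sum]
  simp only [MvPolynomial.esymm_zero, map_one, C_0, zero_mul, mul_zero, add_zero, pow_zero,
    one_mul, derivative_X_pow, mul_add, Finset.mul_sum]
  rw [add_comm]
  congr 1
  refine Finset.sum_congr rfl fun i hi => ?_
  have hi' := Finset.mem_range.mp hi
  rw [derivative_C_mul_X_pow]
  have h5 : n + 2 - (i + 2) ≠ 0 := by omega
  have h6 : ((n + 2 - (i + 2) : ℕ) : ℂ) ≠ 0 := Nat.cast_ne_zero.mpr h5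
  rw [show n + 1 - (i + 1 + 1) = n + 2 - (i + 2) - 1 by omega, ← mul_assoc, ← mul_assoc]
  congr 1
  rw [show ((-1 : ℂ[X]) ^ (i + 1 + 1)) = C ((-1) ^ (i + 2)) by simp, ← C_mul, ← C_mul]
  congr 1
  field_simp
  rfl

/-- Translating the marked critical point of the normal form to the origin. -/
theorem normalForm_comp (α : Fin (n + 1) → ℂ) (β : ℂ) (hα : ∑ i, α i = 0) :
    (normalForm (n + 2) α β).comp (X + C (α 0)) =
      X ^ 2 * cofactor (fun i : Fin n => α i.succ - α 0) + C β := by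
  apply eq_of_derivative_eq_of_eval_zero_eq
  · have hN : derivative (normalForm (n + 2) α β) =
        C ((n + 2 : ℕ) : ℂ) * ∏ i, (X - C (α i)) := by
      rw [normalForm, derivative_add, derivative_sub, derivative_normalFormAux α hα, derivative_C,
        derivative_C, add_zero, sub_zero]
    rw [derivative_comp, hN, Fin.prod_univ_succ]
    simp only [derivative_add, derivative_X_sq_mul_cofactor, derivative_X, derivative_C, add_zero,
      one_mul, mul_comp, sub_comp, X_comp, C_comp, prod_comp, add_sub_cancel_right, mul_assoc]
    congr 2
    refine Finset.prod_congr rfl fun i _ => ?_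
    rw [C_sub]
    ring
  · rw [eval_comp, normalForm]
    simp

theorem MarkedPoly.toModuli_normalForm (f : MarkedPoly (n + 2)) (α : Fin (n + 1) → ℂ) (β : ℂ)
    (hα : ∑ i, α i = 0) (hf : f.poly = normalForm (n + 2) α β) (hc : f.crit = α 0) :
    f.toModuli = (centered (fun i : Fin n => α i.succ - α 0) (β - α 0)).toModuli := by
  refine Quotient.sound (MarkedPoly.conj_symm ⟨1, α 0, one_ne_zero, ?_, ?_⟩)
  · rw [C_1, one_mul, hf, normalForm_comp α β hα]
    simp [centered, add_comp, add_assoc]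
  · simp [centered, hc]

theorem exists_fin_map_eq {A : Type*} {m : ℕ} (s : Multiset A) (h : Multiset.card s = m) :
    ∃ u : Fin m → A, Finset.univ.val.map u = s := by
  subst h
  induction s using Quotient.inductionOn with
  | h L => exact ⟨L.get,
      (Fin.univ_val_map (n := L.length) L.get).trans (congrArg _ (List.ofFn_get L))⟩

/-- Every marked polynomial is conjugate to a centered one. -/
theorem MarkedPoly.exists_toModuli_centered (x : ModuliSpace (n + 2)) :
    ∃ (u : Fin n → ℂ) (b : ℂ), (centered u b).toModuli = x := by
  obtain ⟨f, rfl⟩ := Quotient.exists_rep x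
  set l := f.poly.leadingCoeff with hl
  have hf0 : f.poly ≠ 0 := fun h => by
    have := f.natDegree_eq
    rw [h, natDegree_zero] at this
    omega
  have hl0 : l ≠ 0 := leadingCoeff_ne_zero.mpr hf0
  -- Conjugating by a scaling with factor `a` divides the leading coefficient by `a ^ (n + 1)`.
  obtain ⟨a, ha⟩ := IsAlgClosed.exists_pow_nat_eq l (n := n + 1) (by omega)
  have ha0 : a ≠ 0 := by
    rintro rfl
    exact hl0 (by rw [← ha]; simp)
  let h : ℂ[X] := C a⁻¹ * X + C f.crit
  have hd : h.natDegree = 1 := natDegree_linear (inv_ne_zero ha0)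
  have hlc : h.leadingCoeff = a⁻¹ := leadingCoeff_linear (inv_ne_zero ha0)
  let g : ℂ[X] := C a * f.poly.comp h
  have hgd : g.natDegree = n + 2 := by
    rw [natDegree_C_mul ha0, natDegree_comp, hd, f.natDegree_eq, mul_one]
  have hgm : g.Monic := by
    rw [Monic, leadingCoeff_mul, leadingCoeff_C, leadingCoeff_comp (by omega), hlc, f.natDegree_eq,
      ← hl, ← ha, ← mul_assoc, ← pow_succ', ← mul_pow, mul_inv_cancel₀ ha0, one_pow]
  have hg' : derivative g = (derivative f.poly).comp h := by
    simp only [g, h, derivative_C_mul, derivative_comp, derivative_add, derivative_X, derivative_C,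
      mul_one, add_zero]
    rw [← mul_assoc, ← C_mul, mul_inv_cancel₀ ha0, C_1, one_mul]
  obtain ⟨H, hH⟩ : X ∣ derivative g := by
    rw [X_dvd_iff, coeff_zero_eq_eval_zero, hg', eval_comp]
    simpa [h] using f.isCritical
  have hc0 : ((n + 2 : ℕ) : ℂ) ≠ 0 := Nat.cast_ne_zero.mpr (by omega)
  have hdg : (derivative g).natDegree = n + 1 := by
    rw [natDegree_derivative, hgd]
    rfl
  have hlg : (derivative g).leadingCoeff = ((n + 2 : ℕ) : ℂ) := by
    rw [leadingCoeff, hdg, coeff_derivative]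
    have h1 : g.coeff (n + 1 + 1) = 1 := by rw [← hgm.coeff_natDegree, hgd]
    rw [h1]
    push_cast
    ring
  have hH0 : H ≠ 0 := by
    rintro rfl
    rw [mul_zero] at hH
    rw [hH, leadingCoeff_zero] at hlg
    exact hc0 hlg.symm
  have hHd : H.natDegree = n := by
    rw [hH, natDegree_X_mul hH0] at hdg
    omega
  have hHl : H.leadingCoeff = ((n + 2 : ℕ) : ℂ) := by
    rw [← hlg, hH, leadingCoeff_mul, leadingCoeff_X, one_mul]
  have hsplit := IsAlgClosed.splits H
  have hcard := splits_iff_card_roots.mp hsplit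
  obtain ⟨u, hu⟩ := exists_fin_map_eq H.roots (hcard.trans hHd)
  have hprod : H = C ((n + 2 : ℕ) : ℂ) * ∏ i, (X - C (u i)) := by
    have h1 := C_leadingCoeff_mul_prod_multiset_X_sub_C hcard
    rw [← hu, Multiset.map_map, hHl] at h1
    exact h1.symm
  have hg : g = X ^ 2 * cofactor u + C (g.eval 0) := by
    apply eq_of_derivative_eq_of_eval_zero_eq
    · rw [derivative_add, derivative_C, add_zero, derivative_X_sq_mul_cofactor, hH, mul_comm (C _),
        mul_assoc, ← hprod]
    · simp
  -- The conjugate of `f` by the inverse of `h` is `g - a * f.crit`, since `g` leaves out the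
  -- translation part of that inverse.
  refine ⟨u, g.eval 0 - a * f.crit, Quotient.sound ⟨a⁻¹, f.crit, inv_ne_zero ha0, ?_, ?_⟩⟩
  · have h1 : f.poly.comp h = C a⁻¹ * g := by
      simp only [g]
      rw [← mul_assoc, ← C_mul, inv_mul_cancel₀ ha0, C_1, one_mul]
    refine h1.trans ?_
    simp only [centered, add_comp, mul_comp, C_comp, X_comp]
    conv_lhs => rw [hg]
    rw [C_sub, C_mul]
    have h2 : C a⁻¹ * C a = (1 : ℂ[X]) := by rw [← C_mul, inv_mul_cancel₀ ha0, C_1]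
    linear_combination C f.crit * h2
  · simp [centered]

end Centered

/-! ### Preperiodicity in terms of consecutive orbit differences -/

section Dynamics

theorem MarkedPoly.iterate_sub {d : ℕ} {f g : MarkedPoly d} {a b : ℂ}
    (h : g.poly.comp (C a * X + C b) = (C a * X + C b).comp f.poly)
    (hc : g.crit = a * f.crit + b) (j : ℕ) :
    (fun z => g.poly.eval z)^[j] g.crit = a * (fun z => f.poly.eval z)^[j] f.crit + b := by
  have hs : Function.Semiconj (fun z => a * z + b) (fun z => f.poly.eval z)
      (fun z => g.poly.eval z) := fun z => by
    have := congrArg (Polynomial.eval z) h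
    simpa [eval_comp] using this.symm
  rw [hc]
  exact ((hs.iterate_right j) f.crit).symm

/-- The difference of consecutive points of the orbit of the marked critical point. -/
noncomputable def MarkedPoly.orbitDiff {d : ℕ} (f : MarkedPoly d) (j : ℕ) : ℂ :=
  (fun z => f.poly.eval z)^[j + 1] f.crit - (fun z => f.poly.eval z)^[j] f.crit

theorem MarkedPoly.orbitDiff_conj {d : ℕ} {f g : MarkedPoly d} {a b : ℂ}
    (h : g.poly.comp (C a * X + C b) = (C a * X + C b).comp f.poly)
    (hc : g.crit = a * f.crit + b) (j : ℕ) : g.orbitDiff j = a * f.orbitDiff j := by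
  rw [orbitDiff, orbitDiff, iterate_sub h hc, iterate_sub h hc]
  ring

theorem MarkedPoly.orbitDiff_eq_zero_of_le {d : ℕ} (f : MarkedPoly d) {j k : ℕ} (hjk : j ≤ k)
    (h : f.orbitDiff j = 0) : f.orbitDiff k = 0 := by
  induction k, hjk using Nat.le_induction with
  | base => exact h
  | succ k _ ih =>
    rw [orbitDiff, sub_eq_zero] at ih ⊢
    exact (Function.iterate_succ_apply' _ _ _).trans
      ((congrArg _ ih).trans (Function.iterate_succ_apply' _ _ _).symm)

theorem MarkedPoly.strictlyPreperiodic_zero_iff {d : ℕ} (f : MarkedPoly d) :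
    StrictlyPreperiodic (fun z => f.poly.eval z) 0 1 f.crit ↔ f.orbitDiff 0 = 0 := by
  rw [orbitDiff, sub_eq_zero]
  refine ⟨fun h => h.1, fun h => ⟨h, fun l m hl hm hm' hne => absurd ?_ hne⟩⟩
  rw [Nat.le_zero.mp hl, le_antisymm hm' hm]

/-- With period one only `m = 1` occurs, and once the orbit reaches a fixed point it stays there, so
the single condition at `l = k` implies all those at smaller `l`. -/
theorem MarkedPoly.strictlyPreperiodic_succ_iff {d : ℕ} (f : MarkedPoly d) (k : ℕ) :
    StrictlyPreperiodic (fun z => f.poly.eval z) (k + 1) 1 f.crit ↔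
      f.orbitDiff (k + 1) = 0 ∧ f.orbitDiff k ≠ 0 := by
  constructor
  · rintro ⟨h1, h2⟩
    exact ⟨sub_eq_zero.mpr h1,
      sub_ne_zero.mpr (h2 k 1 (Nat.le_succ k) le_rfl le_rfl (by simp))⟩
  · rintro ⟨h1, h2⟩
    refine ⟨sub_eq_zero.mp h1, fun l m hl hm hm' hne h => h2 ?_⟩
    obtain rfl := le_antisymm hm' hm
    have hlk : l ≠ k + 1 := fun h3 => hne (by rw [h3])
    exact f.orbitDiff_eq_zero_of_le (by omega) (sub_eq_zero.mpr h)

theorem MarkedPoly.toModuli_eq_iff {d : ℕ} {f g : MarkedPoly d} :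
    f.toModuli = g.toModuli ↔ f.Conj g :=
  Quotient.eq

theorem MarkedPoly.Conj.orbitDiff_eq_zero_iff {d : ℕ} {f g : MarkedPoly d} (h : f.Conj g)
    (j : ℕ) : f.orbitDiff j = 0 ↔ g.orbitDiff j = 0 := by
  obtain ⟨a, b, ha, h1, h2⟩ := h
  rw [orbitDiff_conj h1 h2, mul_eq_zero, or_iff_right ha]

theorem toModuli_mem_SigmaSet_zero_iff {d : ℕ} (f : MarkedPoly d) :
    f.toModuli ∈ SigmaSet 0 1 d ↔ f.orbitDiff 0 = 0 := by
  constructor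
  · rintro ⟨g, hg, h⟩
    rw [g.strictlyPreperiodic_zero_iff] at h
    rwa [← (MarkedPoly.toModuli_eq_iff.mp hg).orbitDiff_eq_zero_iff]
  · exact fun h => ⟨f, rfl, f.strictlyPreperiodic_zero_iff.mpr h⟩

theorem toModuli_mem_SigmaSet_succ_iff {d : ℕ} (f : MarkedPoly d) (k : ℕ) :
    f.toModuli ∈ SigmaSet (k + 1) 1 d ↔ f.orbitDiff (k + 1) = 0 ∧ f.orbitDiff k ≠ 0 := by
  constructor
  · rintro ⟨g, hg, h⟩
    rw [g.strictlyPreperiodic_succ_iff] at h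
    rwa [ne_eq, ← (MarkedPoly.toModuli_eq_iff.mp hg).orbitDiff_eq_zero_iff,
      ← (MarkedPoly.toModuli_eq_iff.mp hg).orbitDiff_eq_zero_iff]
  · exact fun h => ⟨f, rfl, (f.strictlyPreperiodic_succ_iff k).mpr h⟩

variable {n : ℕ}

/-- The universal family of cofactors. -/
noncomputable abbrev genericCofactor (n : ℕ) : (MvPolynomial (Fin n) ℂ)[X] :=
  cofactor MvPolynomial.X

theorem MarkedPoly.centered_iterate (u : Fin n → ℂ) (b : ℂ) (j : ℕ) :
    (fun z => (centered u b).poly.eval z)^[j] 0 =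
      (X * normOrbit (genericCofactor n) j).eval₂ (MvPolynomial.eval u) b := by
  have hmap : (genericCofactor n).map (MvPolynomial.eval u) = cofactor u := by
    rw [cofactor_map]
    simp
  rw [eval₂_eq_eval_map, Polynomial.map_mul, map_X, normOrbit_map, hmap]
  induction j with
  | zero => simp [normOrbit]
  | succ j ih =>
    rw [Function.iterate_succ_apply', ih, X_mul_normOrbit_succ]
    simp [centered, eval_comp]

theorem MarkedPoly.centered_orbitDiff (u : Fin n → ℂ) (b : ℂ) (j : ℕ) :
    (centered u b).orbitDiff j =
      (X * (normOrbit (genericCofactor n) (j + 1) - normOrbit (genericCofactor n) j)).eval₂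
        (MvPolynomial.eval u) b := by
  have h (i : ℕ) := centered_iterate u b i
  rw [mul_sub, eval₂_sub, ← h, ← h]
  rfl

end Dynamics

/-! ### Regular functions, closed loci and irreducibility in the moduli space -/

section Regular

variable {n : ℕ}

/-- Translating a centered polynomial so that its critical points sum to zero gives a normal form
whose parameters `(α, β)` are polynomial, indeed linear, in `(u, b)`. -/
theorem IsRegularFunction.exists_polynomial {φ : ModuliSpace (n + 2) → ℂ}
    (hφ : IsRegularFunction φ) :
    ∃ F : (MvPolynomial (Fin n) ℂ)[X], ∀ (u : Fin n → ℂ) (b : ℂ),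
      φ (MarkedPoly.centered u b).toModuli = F.eval₂ (MvPolynomial.eval u) b := by
  obtain ⟨F₀, hF₀⟩ := hφ
  -- Minus the mean of the `n + 1` critical points `0, u i`: the new position of the marked one.
  let c : (MvPolynomial (Fin n) ℂ)[X] :=
    C (MvPolynomial.C (-((n + 1 : ℂ)⁻¹)) * ∑ i, MvPolynomial.X i)
  let x : Fin (n + 1) ⊕ Unit → (MvPolynomial (Fin n) ℂ)[X] :=
    Sum.elim (Fin.cons c fun i => C (MvPolynomial.X i) + c) fun _ => X + c
  let F : (MvPolynomial (Fin n) ℂ)[X] := MvPolynomial.aeval (R := ℂ) x F₀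
  refine ⟨F, fun u b => ?_⟩
  let a : ℂ := -((n + 1 : ℂ)⁻¹) * ∑ i, u i
  let α : Fin (n + 1) → ℂ := Fin.cons a fun i => u i + a
  have hα : ∑ i, α i = 0 := by
    have : (n + 1 : ℂ) ≠ 0 := by exact_mod_cast Nat.succ_ne_zero n
    rw [Fin.sum_univ_succ]
    simp only [α, Fin.cons_zero, Fin.cons_succ, Finset.sum_add_distrib, Finset.sum_const,
      Finset.card_univ, Fintype.card_fin, nsmul_eq_mul, a]
    field_simp
    ring
  have hcomp := normalForm_comp α (b + a) hα
  have hu : (fun i : Fin n => α i.succ - α 0) = u := by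
    funext i
    simp [α]
  have hnf : normalForm (n + 2) α (b + a) =
      (X ^ 2 * cofactor u + C (b + a)).comp (X - C a) := by
    rw [← hu, ← hcomp, comp_assoc]
    simp [α]
  let f : MarkedPoly (n + 2) :=
    { poly := normalForm (n + 2) α (b + a)
      crit := a
      natDegree_eq := by
        rw [hnf, natDegree_comp, natDegree_X_sub_C, mul_one]
        exact (MarkedPoly.centered u (b + a)).natDegree_eq
      isCritical := by
        rw [hnf, derivative_comp]
        simp [eval_comp] }
  have h1 := f.toModuli_normalForm α (b + a) hα rfl rfl
  rw [hu, show b + a - α 0 = b from add_sub_cancel_right b a] at h1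
  rw [← h1, hF₀ f α (b + a) hα rfl rfl]
  have h2 : (eval₂RingHom (MvPolynomial.eval u) b).comp
      (MvPolynomial.aeval (R := ℂ) x : _ →ₐ[ℂ] (MvPolynomial (Fin n) ℂ)[X]).toRingHom =
      MvPolynomial.eval (Sum.elim α fun _ => b + a) := by
    have hc : (c.eval₂ (MvPolynomial.eval u) b) = a := by
      rw [eval₂_C]
      simp only [a, map_mul, map_sum, MvPolynomial.eval_C, MvPolynomial.eval_X]
    apply MvPolynomial.ringHom_ext
    · intro r
      simp [Polynomial.algebraMap_apply]
    · rintro (i | i)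
      · refine Fin.cases ?_ (fun i => ?_) i
        · simp [x, α, hc]
        · simp [x, α, hc]
      · simp [x, hc]
  exact (RingHom.congr_fun h2 F₀).symm

/-- The inverse substitution is `u i = α i.succ - α 0`, `b = β - α 0`. -/
theorem isRegularFunction_of_polynomial {φ : ModuliSpace (n + 2) → ℂ}
    (F : (MvPolynomial (Fin n) ℂ)[X])
    (hF : ∀ (u : Fin n → ℂ) (b : ℂ),
      φ (MarkedPoly.centered u b).toModuli = F.eval₂ (MvPolynomial.eval u) b) :
    IsRegularFunction φ := by
  let x₀ : MvPolynomial (Fin (n + 1) ⊕ Unit) ℂ := MvPolynomial.X (Sum.inl 0)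
  let ψ : MvPolynomial (Fin n) ℂ →ₐ[ℂ] MvPolynomial (Fin (n + 1) ⊕ Unit) ℂ :=
    MvPolynomial.aeval fun i => MvPolynomial.X (Sum.inl i.succ) - x₀
  refine ⟨F.eval₂ ψ.toRingHom (MvPolynomial.X (Sum.inr ()) - x₀), fun f α β hα hf hc => ?_⟩
  rw [f.toModuli_normalForm α β hα hf hc, hF]
  refine Eq.trans ?_ (hom_eval₂ F ψ.toRingHom
    (MvPolynomial.eval (Sum.elim α fun _ => β : Fin (n + 1) ⊕ Unit → ℂ)) _).symm
  have h1 : (MvPolynomial.eval (Sum.elim α fun _ => β : Fin (n + 1) ⊕ Unit → ℂ)).comp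
      ψ.toRingHom = MvPolynomial.eval fun i : Fin n => α i.succ - α 0 := by
    apply MvPolynomial.ringHom_ext
    · intro r
      simp [ψ]
    · intro i
      simp [ψ, x₀]
  rw [h1]
  simp [x₀]

theorem isClosed_commonZeros {d : ℕ} {T : Set (ModuliSpace d → ℂ)}
    (hT : ∀ φ ∈ T, IsRegularFunction φ) : IsClosed (commonZeros T) := by
  rw [← isOpen_compl_iff]
  exact ⟨T, hT, compl_compl _⟩

theorem exists_commonZeros_of_isClosed {d : ℕ} {Z : Set (ModuliSpace d)} (hZ : IsClosed Z) :
    ∃ T : Set (ModuliSpace d → ℂ), (∀ φ ∈ T, IsRegularFunction φ) ∧ Z = commonZeros T := by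
  obtain ⟨T, hT, h⟩ := hZ.isOpen_compl
  exact ⟨T, hT, (compl_compl Z).symm.trans h⟩

/-- The locus in the moduli space where the `j`-th point of the critical orbit is fixed. -/
def fixedLocus (j d : ℕ) : Set (ModuliSpace d) :=
  {x | ∃ f : MarkedPoly d, f.toModuli = x ∧ f.orbitDiff j = 0}

theorem toModuli_mem_fixedLocus_iff {d : ℕ} (f : MarkedPoly d) (j : ℕ) :
    f.toModuli ∈ fixedLocus j d ↔ f.orbitDiff j = 0 := by
  constructor
  · rintro ⟨g, hg, h⟩
    rwa [← (MarkedPoly.toModuli_eq_iff.mp hg).orbitDiff_eq_zero_iff]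
  · exact fun h => ⟨f, rfl, h⟩

/-- The function `lc(f) * (f^{j+1}(c) - f^j(c)) ^ (d - 1)` on the moduli space. -/
noncomputable def orbitDiffFunction (j n : ℕ) : ModuliSpace (n + 2) → ℂ :=
  Quotient.lift (fun f => f.poly.leadingCoeff * f.orbitDiff j ^ (n + 1)) <| by
    rintro f g ⟨a, b, ha, h1, h2⟩
    have hd : (C a * X + C b).natDegree = 1 := natDegree_linear ha
    have hlc : (C a * X + C b).leadingCoeff = a := leadingCoeff_linear ha
    -- Comparing leading coefficients shows that conjugation divides `lc(f)` by `a ^ (n + 1)`,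
    -- exactly compensating the scaling of the orbit difference by `a`.
    have h3 := congrArg leadingCoeff h1
    rw [leadingCoeff_comp (by omega), leadingCoeff_comp (by rw [f.natDegree_eq]; omega), hlc, hd,
      g.natDegree_eq, pow_one, pow_succ, ← mul_assoc, mul_comm a] at h3
    have h4 := mul_right_cancel₀ ha h3
    rw [MarkedPoly.orbitDiff_conj h1 h2, mul_pow, ← mul_assoc, h4]

theorem orbitDiffFunction_toModuli (f : MarkedPoly (n + 2)) (j : ℕ) :
    orbitDiffFunction j n f.toModuli = f.poly.leadingCoeff * f.orbitDiff j ^ (n + 1) :=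
  rfl

theorem isRegularFunction_orbitDiffFunction (j : ℕ) :
    IsRegularFunction (orbitDiffFunction j n) := by
  refine isRegularFunction_of_polynomial ((X * (normOrbit (genericCofactor n) (j + 1) -
    normOrbit (genericCofactor n) j)) ^ (n + 1)) fun u b => ?_
  rw [orbitDiffFunction_toModuli, (MarkedPoly.centered_monic u b).leadingCoeff, one_mul,
    MarkedPoly.centered_orbitDiff, eval₂_pow]

theorem isClosed_fixedLocus (j : ℕ) : IsClosed (fixedLocus j (n + 2)) := by
  have h : fixedLocus j (n + 2) = commonZeros {orbitDiffFunction j n} := by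
    ext x
    obtain ⟨f, rfl⟩ := Quotient.exists_rep x
    refine (toModuli_mem_fixedLocus_iff f j).trans ?_
    have hf0 : f.poly.leadingCoeff ≠ 0 := fun h => by
      have := f.natDegree_eq
      rw [leadingCoeff_eq_zero.mp h, natDegree_zero] at this
      omega
    have h1 := orbitDiffFunction_toModuli f j
    change _ ↔ ∀ φ ∈ ({orbitDiffFunction j n} : Set (ModuliSpace (n + 2) → ℂ)), φ f.toModuli = 0
    simp only [Set.mem_singleton_iff, forall_eq]
    rw [h1, mul_eq_zero, or_iff_right hf0, pow_eq_zero_iff (Nat.succ_ne_zero n)]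
  rw [h]
  exact isClosed_commonZeros (by rintro φ rfl; exact isRegularFunction_orbitDiffFunction j)

/-- The image in the moduli space of an open piece of an irreducible hypersurface is
irreducible. -/
theorem isIrreducible_of_prime {S : Set (ModuliSpace (n + 2))} {q r : (MvPolynomial (Fin n) ℂ)[X]}
    (hq : Prime q) (hr : ¬ q ∣ r)
    (hS : ∀ (u : Fin n → ℂ) (b : ℂ), (MarkedPoly.centered u b).toModuli ∈ S ↔
      q.eval₂ (MvPolynomial.eval u) b = 0 ∧ r.eval₂ (MvPolynomial.eval u) b ≠ 0) :
    IsIrreducible S := by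
  -- If `F` vanishes on the preimage of `S`, then `F * r` vanishes on all of `q = 0`, so the prime
  -- `q` divides `F * r` but not `r`.
  have key {F : (MvPolynomial (Fin n) ℂ)[X]} (hF : ∀ (u : Fin n → ℂ) (b : ℂ),
      (MarkedPoly.centered u b).toModuli ∈ S → F.eval₂ (MvPolynomial.eval u) b = 0) : q ∣ F := by
    refine (hq.dvd_or_dvd (hq.dvd_of_forall_eval₂_eq_zero (F := F * r) fun u b h => ?_)).resolve_right
      hr
    rw [eval₂_mul]
    by_cases h1 : r.eval₂ (MvPolynomial.eval u) b = 0
    · rw [h1, mul_zero]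
    · rw [hF u b ((hS u b).mpr ⟨h, h1⟩), zero_mul]
  constructor
  · by_contra hne
    rw [Set.not_nonempty_iff_eq_empty] at hne
    -- On an empty locus even the constant `1` vanishes, so `q` would be a unit.
    refine hq.not_isUnit (isUnit_of_dvd_one (key fun u b h => ?_))
    rw [hne] at h
    exact h.elim
  -- An open set meeting `S` contains the image of some `F ≠ 0` with `q ∤ F`.
  · have sep {U : Set (ModuliSpace (n + 2))} (hU : IsOpen U) (hSU : (S ∩ U).Nonempty) :
        ∃ F : (MvPolynomial (Fin n) ℂ)[X], ¬ q ∣ F ∧ ∀ (u : Fin n → ℂ) (b : ℂ),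
          F.eval₂ (MvPolynomial.eval u) b ≠ 0 → (MarkedPoly.centered u b).toModuli ∈ U := by
      obtain ⟨T, hT, hUT⟩ := exists_commonZeros_of_isClosed hU.isClosed_compl
      obtain ⟨x, hxS, hxU⟩ := hSU
      have hx : x ∉ commonZeros T := by
        rw [← hUT]
        exact fun h => h hxU
      simp only [commonZeros, Set.mem_ofPred_eq, not_forall] at hx
      obtain ⟨φ, hφ, hφx⟩ := hx
      obtain ⟨F, hF⟩ := (hT φ hφ).exists_polynomial
      obtain ⟨u, b, rfl⟩ := MarkedPoly.exists_toModuli_centered x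
      refine ⟨F, ?_, fun v c hvc => ?_⟩
      · rintro ⟨s, rfl⟩
        rw [hF, eval₂_mul, ((hS u b).mp hxS).1, zero_mul] at hφx
        exact hφx rfl
      · by_contra hcon
        have h1 : (MarkedPoly.centered v c).toModuli ∈ commonZeros T := by
          rw [← hUT]
          exact hcon
        exact hvc ((hF v c).symm.trans (h1 φ hφ))
    intro U V hU hV hSU hSV
    obtain ⟨F, hqF, hF⟩ := sep hU hSU
    obtain ⟨G, hqG, hG⟩ := sep hV hSV
    by_contra hne
    have hFG : q ∣ F * G := key fun u b h => by
      by_contra h1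
      rw [eval₂_mul] at h1
      exact hne ⟨_, h, hF u b (left_ne_zero_of_mul h1), hG u b (right_ne_zero_of_mul h1)⟩
    exact (hq.dvd_or_dvd hFG).elim hqF hqG

/-- The factor is prime. It does not divide `b`, as its constant coefficient is a nonzero multiple
of the product of the `u i`; nor does it divide the normalized difference, whose degree is smaller.
-/
theorem orbitFactor_not_dvd (hn : 0 < n) (k : ℕ)
    (hirr : Irreducible (orbitFactor (genericCofactor n) k)) :
    ¬ orbitFactor (genericCofactor n) k ∣
      X * (normOrbit (genericCofactor n) (k + 1) - normOrbit (genericCofactor n) k) := by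
  obtain ⟨hm, hd⟩ := orbitFactor_monic (cofactor_monic MvPolynomial.X)
    (cofactor_natDegree (MvPolynomial.X : Fin n → MvPolynomial (Fin n) ℂ)) k
  obtain ⟨hm', hd'⟩ := normOrbit_sub_monic (cofactor_monic MvPolynomial.X)
    (cofactor_natDegree (MvPolynomial.X : Fin n → MvPolynomial (Fin n) ℂ)) k
  intro h
  rcases hirr.prime.dvd_or_dvd h with h | h
  · have h1 := X_dvd_iff.mp (hirr.dvd_symm irreducible_X h)
    rw [orbitFactor_coeff_zero, cofactor_coeff, coeff_zero_eq_eval_zero, eval_prod] at h1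
    have h2 : (if k = 0 then 1 else 2 : MvPolynomial (Fin n) ℂ) ≠ 0 := by split_ifs <;> simp
    have h3 : algebraMap ℚ (MvPolynomial (Fin n) ℂ) ((n + 2) / ((0 : ℕ) + 2)) ≠ 0 := by
      rw [ne_eq, map_eq_zero_iff _ (algebraMap ℚ (MvPolynomial (Fin n) ℂ)).injective]
      positivity
    refine mul_ne_zero (mul_ne_zero h3 (Finset.prod_ne_zero_iff.mpr fun i _ => ?_)) h2 h1
    simp [MvPolynomial.X_ne_zero]
  · refine hm.not_dvd_of_natDegree_lt hm'.ne_zero ?_ h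
    rw [hd, hd']
    have h1 : 0 < (n + 2) ^ k := by positivity
    have h2 : 0 < n * (n + 2) ^ k := by positivity
    have h3 : (n + 1) * (n + 2) ^ k = n * (n + 2) ^ k + (n + 2) ^ k := by ring
    omega

end Regular

/-- For every `k ≥ 0` and every odd prime `p`, the set of points of the moduli space of degree `p`
polynomials with a marked critical point at which the marked critical point is strictly
`(k, 1)`-preperiodic is quasi-affine (locally closed) and irreducible in the Zariski topology. -/
theorem theorem5p10 (k p : ℕ) (hp : p.Prime) (hodd : Odd p) :
    IsLocallyClosed (SigmaSet k 1 p) ∧ IsIrreducible (SigmaSet k 1 p) := by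
  obtain ⟨n, rfl⟩ : ∃ n, p = n + 2 := ⟨p - 2, by have := hp.two_le; omega⟩
  have hn : 0 < n := by
    rcases Nat.eq_zero_or_pos n with rfl | h
    · exact absurd hodd (by decide)
    · exact h
  rcases k with _ | k
  · constructor
    · have h : SigmaSet 0 1 (n + 2) = fixedLocus 0 (n + 2) := by
        ext x
        obtain ⟨f, rfl⟩ := Quotient.exists_rep x
        exact (toModuli_mem_SigmaSet_zero_iff f).trans (toModuli_mem_fixedLocus_iff f 0).symm
      rw [h]
      exact (isClosed_fixedLocus 0).isLocallyClosed
    -- The first orbit difference is `b` itself.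
    · refine isIrreducible_of_prime (q := X) (r := 1) prime_X
        (fun h => prime_X.not_isUnit (isUnit_of_dvd_one h)) fun u b => ?_
      rw [toModuli_mem_SigmaSet_zero_iff, MarkedPoly.centered_orbitDiff]
      simp [normOrbit]
  · constructor
    · have h : SigmaSet (k + 1) 1 (n + 2) =
          fixedLocus (k + 1) (n + 2) ∩ (fixedLocus k (n + 2))ᶜ := by
        ext x
        obtain ⟨f, rfl⟩ := Quotient.exists_rep x
        exact (toModuli_mem_SigmaSet_succ_iff f k).trans
          (and_congr (toModuli_mem_fixedLocus_iff f _).symm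
            (not_congr (toModuli_mem_fixedLocus_iff f _).symm))
      rw [h]
      exact (isClosed_fixedLocus _).isLocallyClosed.inter
        (isClosed_fixedLocus _).isOpen_compl.isLocallyClosed
    · have hirr := orbitFactor_cofactor_irreducible hp hn rfl k
      refine isIrreducible_of_prime hirr.prime (orbitFactor_not_dvd hn k hirr) fun u b => ?_
      rw [toModuli_mem_SigmaSet_succ_iff, MarkedPoly.centered_orbitDiff,
        MarkedPoly.centered_orbitDiff]
      -- Where `a_{k+1} ≠ a_k` also `b ≠ 0`, since `b` divides that difference; so the next
      -- difference vanishes exactly when the factor does.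
      refine and_congr_left fun h => ?_
      rw [normOrbit_succ_sub, ← mul_assoc, eval₂_mul, mul_eq_zero, or_iff_right h, eval₂_mul,
        mul_eq_zero, or_iff_right]
      intro h1
      rw [eval₂_mul, h1, zero_mul] at h
      exact h rfl
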